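/- Let $\mathcal C$ be a locally noetherian Grothendieck category, i.e. a Grothendieck category with a set of noetherian generators. A full subcategory $\mathcal L$ of $\mathcal C$ is \emph{localizing} if it is closed under subobjects, quotient objects, extensions and arbitrary direct sums; a localizing subcategory is \emph{stable} if it is also closed under essential extensions. For a localizing subcategory $\mathcal L$, let $Z(\mathcal C/\mathcal L)$ be the commutative ring of endomorphisms of the identity functor of the quotient category $\mathcal C/\mathcal L$; for $\mathcal L\subseteq\mathcal L'$ the quotient functor $\mathcal C/\mathcal L\to\mathcal C/\mathcal L'$ induces a ring homomorphism $Z(\mathcal C/\mathcal L)\to Z(\mathcal C/\mathcal L')$, called restriction. Let $\mathbf{Sp}(\mathcal C)$ be the set of isomorphism classes of indecomposable injective objects of $\mathcal C$, choose a representative $E_x$ of each $x\in\mathbf{Sp}(\mathcal C)$, and for a localizing subcategory $\mathcal L$ let $$A(\mathcal L)=\{x\in\mathbf{Sp}(\mathcal C): E_x\text{ has no non-zero subobject in }\mathcal L\}.$$ A subset of $\mathbf{Sp}(\mathcal C)$ is \emph{stable} if it is of the form $A(\mathcal L)$ with $\mathcal L$ a stable localizing subcategory. For $A\subseteq\mathbf{Sp}(\mathcal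 C)$ let $\mathcal L_A$ be the localizing subcategory of all objects $M$ with $\operatorname{Hom}_{\mathcal C}(M,E_x)=0$ for all $x\in A$. Then: (1) The stable subsets are precisely the open subsets of a topology on $\mathbf{Sp}(\mathcal C)$ (the \emph{stable topology}), and for every stable subset $A$ the subcategory $\mathcal L_A$ is the unique stable localizing subcategory $\mathcal L$ with $A(\mathcal L)=A$. (2) The presheaf of commutative rings $A\mapsto Z(\mathcal C/\mathcal L_A)$, with the restriction maps above, is a sheaf on $\mathbf{Sp}(\mathcal C)$ for the stable topology. (3) Equivalently, the presheaf $\mathcal L\mapsto Z(\mathcal C/\mathcal L)$ on stable localizing subcategories (ordered by reverse inclusion) satisfies the sheaf condition for arbitrary coverings: for every family $(\mathcal L_i)_{i\in I}$ of stable localizing subcategories and every family of elements $z_i\in Z(\mathcal C/\mathcal L_i)$ such that, for all $i,j\in I$, $z_i$ and $z_j$ have the same restriction to $Z(\mathcal C/(\mathcal L_i\vee\mathcal L_j))$, where $\mathcal L_i\vee\mathcal L_j$ is the smallest localizing subcategory containing $\mathcal L_i$ and $\mathcal L_j$, there is a unique $z\in Z\big(\mathcal C/\bigcap_{i}\mathcal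 L_i\big)$ whose restriction to $Z(\mathcal C/\mathcal L_i)$ is $z_i$ for every $i\in I$. -/

import Mathlib

open CategoryTheory CategoryTheory.Limits TopologicalSpace Opposite

universe w v u

noncomputable section

namespace CentralSheaf

variable {C : Type u} [Category.{v} C] [Abelian C]

/-! ### Localizing subcategories -/

/-- A localizing subcategory of `C`: a (strictly) full subcategory closed under subobjects,
quotient objects, extensions and arbitrary (small) direct sums. -/
structure IsLocalizing (P : ObjectProperty C) : Prop where
  isSerreClass : P.IsSerreClass
  coproducts : ∀ ι : Type v, P.IsClosedUnderColimitsOfShape (Discrete ι)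

variable (C) in
/-- The localizing subcategories of `C`, ordered by inclusion. -/
@[ext]
structure LocalizingSubcategory where
  prop : ObjectProperty C
  isLocalizing : IsLocalizing prop

namespace LocalizingSubcategory

instance (L : LocalizingSubcategory C) : L.prop.IsSerreClass := L.isLocalizing.isSerreClass

instance : PartialOrder (LocalizingSubcategory C) :=
  PartialOrder.lift prop (fun _ _ h => LocalizingSubcategory.ext h)

/-- The intersection of a family of localizing subcategories. -/
instance : InfSet (LocalizingSubcategory C) where
  sInf S :=
    { prop := fun X => ∀ L ∈ S, L.prop X
      isLocalizing :=
        { isSerreClass :=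
            { exists_zero := ⟨_, isZero_zero C, fun L _ => L.prop.prop_zero⟩
              prop_of_mono := fun f _ hY L hL => L.prop.prop_of_mono f (hY L hL)
              prop_of_epi := fun f _ hX L hL => L.prop.prop_of_epi f (hX L hL)
              prop_X₂_of_shortExact := fun hS h₁ h₃ L hL =>
                L.prop.prop_X₂_of_shortExact hS (h₁ L hL) (h₃ L hL) }
          coproducts := fun ι => ⟨by
            rintro X ⟨h⟩ L hL
            have := L.isLocalizing.coproducts ι
            exact L.prop.prop_of_isColimit h.isColimit (fun j => h.prop_diag_obj j L hL)⟩ } }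

/-- The lattice of localizing subcategories: infima are intersections, and `L₁ ⊔ L₂` is the
smallest localizing subcategory containing `L₁` and `L₂`. -/
instance : CompleteLattice (LocalizingSubcategory C) :=
  completeLatticeOfInf _ (fun _ =>
    ⟨fun L hL _ hX => hX L hL, fun _ hL' _ hX _ hL => hL' hL _ hX⟩)

/-- `L` is stable if it is closed under essential extensions: if `f : X ⟶ Y` is a monomorphism
such that every subobject of `Y` meeting `X` trivially is zero, and `X` lies in `L`, then `Y` lies
in `L`. -/
def IsStable (L : LocalizingSubcategory C) : Prop :=
  ∀ ⦃X Y : C⦄ (f : X ⟶ Y) [Mono f],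
    (∀ S : Subobject Y, S ⊓ Subobject.mk f = ⊥ → S = ⊥) → L.prop X → L.prop Y

/-- `Y` is `L`-torsion-free if it has no non-zero subobject lying in `L`. -/
def IsTorsionFree (L : LocalizingSubcategory C) (Y : C) : Prop :=
  ∀ S : Subobject Y, L.prop (S : C) → S = ⊥

/-! ### Quotient categories and their centers -/

/-- The quotient category `C/L`: the localization of `C` at the morphisms whose kernel and
cokernel lie in `L`. -/
abbrev QuotientCategory (L : LocalizingSubcategory C) : Type u := L.prop.isoModSerre.Localization

/-- The quotient functor `C ⥤ C/L`. -/
abbrev quotFunctor (L : LocalizingSubcategory C) : C ⥤ L.QuotientCategory := L.prop.isoModSerre.Q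

lemma isoModSerre_le {L L' : LocalizingSubcategory C} (h : L ≤ L') :
    L.prop.isoModSerre ≤ L'.prop.isoModSerre :=
  fun _ _ _ hf => ⟨h _ hf.1, h _ hf.2⟩

lemma quotFunctor_inverts {L L' : LocalizingSubcategory C} (h : L ≤ L') :
    L.prop.isoModSerre.IsInvertedBy L'.quotFunctor :=
  fun _ _ f hf => L'.prop.isoModSerre.Q_inverts f (isoModSerre_le h f hf)

/-- For `L ≤ L'`, the natural functor `C/L ⥤ C/L'` through which `C ⥤ C/L'` factors. -/
def quotMap {L L' : LocalizingSubcategory C} (h : L ≤ L') : L.QuotientCategory ⥤ L'.QuotientCategory :=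
  Localization.Construction.lift L'.quotFunctor (quotFunctor_inverts h)

lemma quotFunctor_comp_quotMap {L L' : LocalizingSubcategory C} (h : L ≤ L') :
    L.quotFunctor ⋙ quotMap h = L'.quotFunctor :=
  Localization.Construction.fac _ _

lemma quotMap_refl (L : LocalizingSubcategory C) : quotMap (le_refl L) = 𝟭 _ :=
  Localization.Construction.uniq _ _ (quotFunctor_comp_quotMap _)

lemma quotMap_comp {L₁ L₂ L₃ : LocalizingSubcategory C} (h : L₁ ≤ L₂) (h' : L₂ ≤ L₃) :
    quotMap h ⋙ quotMap h' = quotMap (h.trans h') :=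
  Localization.Construction.uniq _ _ (by
    rw [← Functor.assoc, quotFunctor_comp_quotMap, quotFunctor_comp_quotMap,
      quotFunctor_comp_quotMap])

instance {L L' : LocalizingSubcategory C} (h : L ≤ L') :
    (quotMap h).IsLocalization (L'.prop.isoModSerre.map L.quotFunctor) := by
  have : (L.quotFunctor ⋙ quotMap h).IsLocalization L'.prop.isoModSerre := by
    rw [quotFunctor_comp_quotMap]; infer_instance
  exact Functor.IsLocalization.of_comp L.quotFunctor _ L.prop.isoModSerre _ L'.prop.isoModSerre
    (isoModSerre_le h) rfl

instance {L L' : LocalizingSubcategory C} (h : L ≤ L') : (quotMap h).Additive := by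
  rw [Localization.functor_additive_iff L.quotFunctor L.prop.isoModSerre,
    quotFunctor_comp_quotMap]
  infer_instance

instance (L : LocalizingSubcategory C) : CommRing (CatCenter L.QuotientCategory) :=
  { (inferInstance : Ring (CatCenter L.QuotientCategory)) with
    mul_comm := mul_comm' }

/-- The commutative ring `Z(C/L)` of endomorphisms of the identity functor of `C/L`. -/
def center (L : LocalizingSubcategory C) : CommRingCat.{max u v} :=
  CommRingCat.of (CatCenter L.QuotientCategory)

/-- For `L ≤ L'`, the ring homomorphism `Z(C/L) ⟶ Z(C/L')` induced by the quotient functor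
`C/L ⥤ C/L'`. -/
def centerMap {L L' : LocalizingSubcategory C} (h : L ≤ L') : L.center ⟶ L'.center :=
  CommRingCat.ofHom
    (CatCenter.localizationRingHom (quotMap h) (L'.prop.isoModSerre.map L.quotFunctor))

lemma centerMap_app {L L' : LocalizingSubcategory C} (h : L ≤ L')
    (z : CatCenter L.QuotientCategory) (X : C) :
    CatCenter.app ((centerMap h).hom z : CatCenter L'.QuotientCategory) (L'.quotFunctor.obj X) =
      (quotMap h).map (z.app (L.quotFunctor.obj X)) :=
  CatCenter.localization_app z (quotMap h) (L'.prop.isoModSerre.map L.quotFunctor)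
    (L.quotFunctor.obj X)

variable (C) in
/-- The assignment `L ↦ Z(C/L)`, as a functor on the poset of localizing subcategories. -/
def centerFunctor : LocalizingSubcategory C ⥤ CommRingCat.{max u v} where
  obj L := L.center
  map f := centerMap (leOfHom f)
  map_id L := by
    ext z
    refine CatCenter.ext_of_localization L.quotFunctor L.prop.isoModSerre _ _ fun X => ?_
    refine (centerMap_app _ z X).trans ?_
    have h : (quotMap (le_refl L)).map (CatCenter.app z (L.quotFunctor.obj X)) ≍
        CatCenter.app z (L.quotFunctor.obj X) := by
      rw [quotMap_refl]; rfl
    exact eq_of_heq h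
  map_comp {L₁ L₂ L₃} f g := by
    ext z
    refine CatCenter.ext_of_localization L₃.quotFunctor L₃.prop.isoModSerre _ _ fun X => ?_
    refine (centerMap_app _ z X).trans ?_
    have h : (quotMap ((leOfHom f).trans (leOfHom g))).map
          (CatCenter.app z (L₁.quotFunctor.obj X)) ≍
        (quotMap (leOfHom g)).map ((quotMap (leOfHom f)).map
          (CatCenter.app z (L₁.quotFunctor.obj X))) := by
      rw [← quotMap_comp (leOfHom f) (leOfHom g)]; rfl
    refine (eq_of_heq h).trans (Eq.trans ?_ (centerMap_app (leOfHom g) ((centerMap (leOfHom f)).hom z) X).symm)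
    exact congrArg (quotMap (leOfHom g)).map (centerMap_app (leOfHom f) z X).symm

end LocalizingSubcategory

/-! ### The injective spectrum -/

variable (C) in
/-- The indecomposable injective objects of `C`. -/
def IndecomposableInjective : Type u := {E : C // Injective E ∧ Indecomposable E}

variable (C) in
/-- Isomorphism of indecomposable injective objects. -/
instance indecomposableInjectiveSetoid : Setoid (IndecomposableInjective C) where
  r E E' := Nonempty (E.1 ≅ E'.1)
  iseqv :=
    { refl := fun E => ⟨Iso.refl E.1⟩
      symm := fun ⟨e⟩ => ⟨e.symm⟩
      trans := fun ⟨e⟩ ⟨e'⟩ => ⟨e.trans e'⟩ }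

variable (C) in
/-- The injective spectrum `Sp(C)`: the isomorphism classes of indecomposable injective objects. -/
def InjectiveSpectrum : Type u := Quotient (indecomposableInjectiveSetoid C)

namespace InjectiveSpectrum

/-- A chosen representative `E_x` of the isomorphism class `x`. -/
def rep (x : InjectiveSpectrum C) : C := (Quotient.out x).1

instance (x : InjectiveSpectrum C) : Injective x.rep := (Quotient.out x).2.1

/-- `A(L)`: the classes of the `L`-torsion-free indecomposable injectives. -/
def torsionFreeLocus (L : LocalizingSubcategory C) : Set (InjectiveSpectrum C) :=
  {x | L.IsTorsionFree x.rep}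

/-- A subset of `Sp(C)` is stable if it is `A(L)` for some stable localizing subcategory `L`. -/
def IsStableSubset (A : Set (InjectiveSpectrum C)) : Prop :=
  ∃ L : LocalizingSubcategory C, L.IsStable ∧ torsionFreeLocus L = A

/-- The stable topology on `Sp(C)`, generated by the stable subsets. -/
instance : TopologicalSpace (InjectiveSpectrum C) :=
  TopologicalSpace.generateFrom {A | IsStableSubset A}

/-- `L_A`: the localizing subcategory cogenerated by the `E_x` with `x ∈ A`, consisting of the
objects `M` such that `Hom(M, E_x) = 0` for all `x ∈ A`. -/
def localizingOf (A : Set (InjectiveSpectrum C)) : LocalizingSubcategory C where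
  prop M := ∀ x ∈ A, ∀ f : M ⟶ x.rep, f = 0
  isLocalizing :=
    { isSerreClass :=
        { exists_zero := ⟨_, isZero_zero C, fun x _ f => (isZero_zero C).eq_of_src f 0⟩
          prop_of_mono := fun i _ hY x hx f => by
            rw [← Injective.comp_factorThru f i, hY x hx (Injective.factorThru f i), comp_zero]
          prop_of_epi := fun p _ hX x hx f => by
            rw [← cancel_epi p, hX x hx (p ≫ f), comp_zero]
          prop_X₂_of_shortExact := fun {S} hS h₁ h₃ x hx f => by
            have := hS.epi_g
            rw [← hS.exact.g_desc f (h₁ x hx (S.f ≫ f)), h₃ x hx (hS.exact.desc f _), comp_zero] }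
      coproducts := fun ι => ⟨by
        rintro X ⟨h⟩ x hx f
        exact h.isColimit.hom_ext fun j => by
          rw [h.prop_diag_obj j x hx (_ ≫ f), comp_zero]⟩ }

lemma localizingOf_antitone {A B : Set (InjectiveSpectrum C)} (h : A ⊆ B) :
    localizingOf B ≤ localizingOf A :=
  fun _ hM x hx => hM x (h hx)

end InjectiveSpectrum

variable (C) in
/-- The presheaf of commutative rings `A ↦ Z(C/L_A)` on `Sp(C)` with the stable topology. -/
def centralPresheaf :
    TopCat.Presheaf CommRingCat.{max u v} (TopCat.of (InjectiveSpectrum C)) where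
  obj A := (InjectiveSpectrum.localizingOf (A.unop : Set (InjectiveSpectrum C))).center
  map f := LocalizingSubcategory.centerMap
    (InjectiveSpectrum.localizingOf_antitone (leOfHom f.unop))
  map_id _ := (LocalizingSubcategory.centerFunctor C).map_id _
  map_comp f g := (LocalizingSubcategory.centerFunctor C).map_comp
    (homOfLE (InjectiveSpectrum.localizingOf_antitone (leOfHom f.unop)))
    (homOfLE (InjectiveSpectrum.localizingOf_antitone (leOfHom g.unop)))

variable (C) in
/-- `C` is locally noetherian: it has a (small) set of noetherian generators. -/
def IsLocallyNoetherianCategory : Prop :=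
  ∃ P : ObjectProperty C, ObjectProperty.Small.{v} P ∧ (∀ X, P X → IsNoetherianObject X) ∧
    P.IsSeparating

end CentralSheaf

end

open CentralSheaf

noncomputable section

namespace CentralSheaf

set_option linter.unusedSectionVars false

variable {C : Type u} [Category.{v} C] [Abelian C]

/-! Everything is read off from the indecomposable injectives. A noetherian object maps, with kernel
in `L`, to a finite direct sum of `L`-torsion-free objects `E_x`
(`exists_monoModSerre_isFiniteSum`). Since noetherian objects generate, `L` is cogenerated by those
`E_x`, so `A(L)` determines `L` (`localizingOf_torsionFreeLocus`).

Stability is a dichotomy: `L` is stable if and only if every `E_x` is either in `L` or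
`L`-torsion-free, because a nonzero subobject of `E_x` is essential. Hence suprema and intersections
of stable subcategories are stable and correspond to intersections and unions of loci, which gives
the topology.

If `E` is injective and torsion-free, morphisms to it are the same in `C` and in `C/L`. A central
element of `C/L` therefore amounts to endomorphisms of the torsion-free `E_x` commuting with all
morphisms between them (`exists_center_of_endomorphisms`, `center_ext`). Such families glue: for `f
: E_x ⟶ E_y` with `y ∈ A(L_j)`, either `E_x` is in `L_j` and `f = 0`, or both objects are
`L_j`-torsion-free and commutation holds in `C/L_j`. Both sheaf statements are instances of
`existsUnique_center`, whose conditions on overlaps involve only the loci. -/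

/-! ### Essential monomorphisms and injective hulls -/

/-- A monomorphism `f : X ⟶ Y` is essential if any morphism from `Y` whose restriction to `X` is
a monomorphism is a monomorphism. -/
structure IsEssential {X Y : C} (f : X ⟶ Y) : Prop where
  mono : Mono f
  mono_of_comp : ∀ ⦃Z : C⦄ (g : Y ⟶ Z), Mono (f ≫ g) → Mono g

lemma IsEssential.comp {X Y Z : C} {f : X ⟶ Y} {g : Y ⟶ Z} (hf : IsEssential f)
    (hg : IsEssential g) : IsEssential (f ≫ g) where
  mono := by
    have := hf.mono
    have := hg.mono
    infer_instance
  mono_of_comp W h hh := hg.mono_of_comp _ (hf.mono_of_comp _ (by simpa using hh))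

lemma subobject_eq_bot_of_isZero {Y : C} {S : Subobject Y} (hS : IsZero (S : C)) : S = ⊥ := by
  rw [← Subobject.mk_arrow S, Subobject.mk_eq_bot_iff_zero]
  exact hS.eq_of_src _ _

lemma isZero_of_subobject_eq_bot {Y : C} {S : Subobject Y} (hS : S = ⊥) : IsZero (S : C) := by
  rw [← Subobject.mk_arrow S, Subobject.mk_eq_bot_iff_zero] at hS
  exact IsZero.of_mono_eq_zero _ hS

/-- The kernel of `g` meets `S` trivially if and only if `g` is a monomorphism on `S`. -/
lemma inf_kernelSubobject_eq_bot_iff {Y Z : C} (S : Subobject Y) (g : Y ⟶ Z) :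
    S ⊓ kernelSubobject g = ⊥ ↔ Mono (S.arrow ≫ g) := by
  constructor
  · intro h
    refine Preadditive.mono_of_cancel_zero _ fun {W} k hk => ?_
    have : (S ⊓ kernelSubobject g).Factors (k ≫ S.arrow) := by
      rw [Subobject.inf_factors]
      exact ⟨Subobject.factors_comp_arrow k, kernelSubobject_factors _ _ (by simpa using hk)⟩
    rw [h, Subobject.bot_factors_iff_zero] at this
    rwa [← cancel_mono S.arrow, zero_comp]
  · intro h
    refine subobject_eq_bot_of_isZero ((IsZero.iff_id_eq_zero _).2 ?_)
    rw [← cancel_mono (Subobject.ofLE _ S inf_le_left), ← cancel_mono (S.arrow ≫ g)]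
    have := (kernelSubobject_factors_iff g _).1
      (Subobject.inf_arrow_factors_right S (kernelSubobject g))
    simp [this]

lemma mono_comp_iff {X Y Z : C} (f : X ⟶ Y) [Mono f] (g : Y ⟶ Z) :
    Mono (f ≫ g) ↔ Subobject.mk f ⊓ kernelSubobject g = ⊥ := by
  rw [inf_kernelSubobject_eq_bot_iff]
  constructor
  · intro h
    have : (Subobject.mk f).arrow ≫ g = (Subobject.underlyingIso f).hom ≫ f ≫ g := by simp
    rw [this]
    infer_instance
  · intro h
    have : f ≫ g = (Subobject.underlyingIso f).inv ≫ (Subobject.mk f).arrow ≫ g := by simp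
    rw [this]
    infer_instance

lemma kernelSubobject_eq_bot_iff {Y Z : C} (g : Y ⟶ Z) : kernelSubobject g = ⊥ ↔ Mono g := by
  have h := mono_comp_iff (𝟙 Y) g
  rw [Category.id_comp, ← Subobject.top_eq_id, top_inf_eq] at h
  exact h.symm

lemma kernelSubobject_cokernel_arrow {Y : C} (S : Subobject Y) :
    kernelSubobject (cokernel.π S.arrow) = S := by
  refine le_antisymm ?_ (le_kernelSubobject _ _ (cokernel.condition _))
  exact Subobject.le_of_comm (Abelian.monoLift S.arrow _ (kernelSubobject_arrow_comp _))
    (Abelian.monoLift_comp _ _ _)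

lemma mono_of_kernelSubobject_comp_le {X Y Z : C} (q : X ⟶ Y) [Epi q] (h : Y ⟶ Z)
    (hle : kernelSubobject (q ≫ h) ≤ kernelSubobject q) : Mono h := by
  refine Preadditive.mono_of_cancel_zero _ fun {W} z hz => ?_
  obtain ⟨A, π, _, x, hx⟩ := surjective_up_to_refinements_of_epi q z
  have hf := Subobject.factors_of_le x hle
    (kernelSubobject_factors _ _ (by rw [← reassoc_of% hx, hz, comp_zero]))
  rw [kernelSubobject_factors_iff, ← hx] at hf
  rwa [← cancel_epi π, comp_zero]

/-- Subobjects of `Y` and kernels of morphisms out of `Y` are the same thing, so the test on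
morphisms agrees with the test on subobjects used in `IsStable`. -/
lemma isEssential_iff {X Y : C} (f : X ⟶ Y) [Mono f] :
    IsEssential f ↔ ∀ S : Subobject Y, S ⊓ Subobject.mk f = ⊥ → S = ⊥ := by
  constructor
  · intro h S hS
    have := h.mono_of_comp (cokernel.π S.arrow) (by
      rwa [mono_comp_iff, kernelSubobject_cokernel_arrow, inf_comm])
    rwa [← kernelSubobject_eq_bot_iff, kernelSubobject_cokernel_arrow] at this
  · intro h
    refine ⟨inferInstance, fun Z g hg => ?_⟩
    rw [mono_comp_iff, inf_comm] at hg
    exact (kernelSubobject_eq_bot_iff g).1 (h _ hg)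

lemma IsEssential.of_isIso {X Y : C} (f : X ⟶ Y) [IsIso f] : IsEssential f where
  mono := inferInstance
  mono_of_comp Z g hg := by simpa using mono_comp (inv f) (f ≫ g)

section Directed

variable [IsGrothendieckAbelian.{v} C]

/-- This is AB5: the union is a filtered colimit of its members, and filtered colimits of
monomorphisms are monomorphisms. It supplies the upper bounds of chains for Zorn's lemma below. -/
lemma mono_of_directed_iSup {X Y : C} {J : Type v} [PartialOrder J] [Nonempty J]
    [IsDirectedOrder J] (S : J → Subobject X) (hS : Monotone S) (T : Subobject X)
    (hT : T = ⨆ j, S j) (g : (T : C) ⟶ Y) (hST : ∀ j, S j ≤ T)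
    (h : ∀ j, Mono (Subobject.ofLE _ _ (hST j) ≫ g)) :
    Mono g := by
  let F : J ⥤ MonoOver X :=
    { obj j := MonoOver.mk (S j).arrow
      map {a b} f := MonoOver.homMk (Subobject.ofLE (S a) (S b) (hS f.le)) (Subobject.ofLE_arrow _) }
  let c : Cocone (F ⋙ MonoOver.forget _) :=
    { pt := Over.mk T.arrow
      ι :=
        { app j := Over.homMk (Subobject.ofLE _ _ (hST j))
          naturality a b f := by
            ext
            change Subobject.ofLE _ _ _ ≫ Subobject.ofLE _ _ _ = Subobject.ofLE _ _ _ ≫ 𝟙 _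
            simp } }
  have : Mono c.pt.hom := inferInstanceAs (Mono T.arrow)
  have hc := IsGrothendieckAbelian.isColimitMapCoconeOfSubobjectMkEqISup F c (by
    change Subobject.mk T.arrow = ⨆ j, Subobject.mk (S j).arrow
    simpa only [Subobject.mk_arrow] using hT)
  let F' : J ⥤ MonoOver Y :=
    { obj j := MonoOver.mk (Subobject.ofLE _ _ (hST j) ≫ g)
      map {a b} f := MonoOver.homMk (Subobject.ofLE (S a) (S b) (hS f.le)) (by
        change Subobject.ofLE _ _ _ ≫ Subobject.ofLE _ _ _ ≫ g = Subobject.ofLE _ _ _ ≫ g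
        simp) }
  exact IsGrothendieckAbelian.mono_of_isColimit_monoOver F' hc g (fun j => rfl)

lemma mono_of_directedOn_sSup {X Y : C} (s : Set (Subobject X)) (hs : DirectedOn (· ≤ ·) s)
    (hne : s.Nonempty) (g : ((sSup s : Subobject X) : C) ⟶ Y)
    (h : ∀ (c : Subobject X) (hc : c ∈ s), Mono (Subobject.ofLE c _ (le_sSup hc) ≫ g)) :
    Mono g := by
  let e : Shrink.{v} s ≃ s := (equivShrink s).symm
  let : PartialOrder (Shrink.{v} s) := PartialOrder.lift (fun j => (e j).1)
    (Subtype.val_injective.comp e.injective)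
  have : Nonempty (Shrink.{v} s) := ⟨e.symm ⟨_, hne.choose_spec⟩⟩
  have : IsDirectedOrder (Shrink.{v} s) := ⟨fun a b => by
    obtain ⟨c, hc, h₁, h₂⟩ := hs _ (e a).2 _ (e b).2
    refine ⟨e.symm ⟨c, hc⟩, ?_, ?_⟩
    · change (e a).1 ≤ (e _).1
      simpa using h₁
    · change (e b).1 ≤ (e _).1
      simpa using h₂⟩
  refine mono_of_directed_iSup (fun j => (e j).1) (fun _ _ h => h) (sSup s) ?_ g
    (fun j => le_sSup (e j).2) (fun j => h _ (e j).2)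
  rw [sSup_eq_iSup']
  exact (e.iSup_comp (g := fun x : s => (x : Subobject X))).symm

lemma mono_sSup_arrow_comp {X Y : C} (s : Set (Subobject X)) (hs : DirectedOn (· ≤ ·) s)
    (hne : s.Nonempty) (g : X ⟶ Y) (h : ∀ c ∈ s, Mono (Subobject.arrow c ≫ g)) :
    Mono ((sSup s).arrow ≫ g) :=
  mono_of_directedOn_sSup s hs hne _ (fun c hc => by simpa using h c hc)

/-- Any monomorphism into an injective object factors through an injective hull of its source. -/
theorem exists_injective_hull {I N : C} [Injective I] (k : N ⟶ I) [Mono k] :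
    ∃ (F : C) (_ : Injective F) (i : N ⟶ F) (j : F ⟶ I), IsEssential i ∧ i ≫ j = k := by
  -- `E` will be a maximal essential extension of `N` inside `I`.
  let 𝓔 : Set (Subobject I) := {E | ∃ i : N ⟶ (E : C), IsEssential i ∧ i ≫ E.arrow = k}
  obtain ⟨E, -, ⟨i, hi, hik⟩, hE⟩ := zorn_le_nonempty₀ 𝓔 (by
    intro c hc hchain E₀ hE₀
    refine ⟨sSup c, ?_, fun _ => le_sSup⟩
    obtain ⟨i, hi, hik⟩ := hc hE₀
    have := hi.mono
    refine ⟨i ≫ Subobject.ofLE _ _ (le_sSup hE₀), ⟨inferInstance, fun Z g hg => ?_⟩, by simpa⟩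
    refine mono_of_directedOn_sSup c hchain.directedOn ⟨_, hE₀⟩ g fun E hE => ?_
    obtain ⟨i', hi', hik'⟩ := hc hE
    refine hi'.mono_of_comp _ ?_
    have : i' ≫ Subobject.ofLE _ _ (le_sSup hE) = i ≫ Subobject.ofLE _ _ (le_sSup hE₀) := by
      rw [← cancel_mono (sSup c).arrow]
      simp [hik, hik']
    rwa [reassoc_of% this, ← Category.assoc]) (Subobject.mk k)
    ⟨(Subobject.underlyingIso k).inv, IsEssential.of_isIso _, by simp⟩
  -- `K` is maximal among the subobjects of `I` meeting `E` trivially; maximality makes `E ⟶ I/K`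
  -- essential.
  obtain ⟨K, -, hK, hKmax⟩ := zorn_le_nonempty₀
    {K : Subobject I | Mono (K.arrow ≫ cokernel.π E.arrow)} (by
    intro c hc hchain K₀ hK₀
    exact ⟨sSup c, mono_sSup_arrow_comp c hchain.directedOn ⟨_, hK₀⟩ _ (fun K hK => hc hK),
      fun _ => le_sSup⟩) ⊥ (by
    rw [Set.mem_ofPred_eq, ← inf_kernelSubobject_eq_bot_iff, bot_inf_eq])
  rw [Set.mem_ofPred_eq, ← inf_kernelSubobject_eq_bot_iff, kernelSubobject_cokernel_arrow] at hK
  let q := cokernel.π K.arrow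
  have hq : IsEssential (E.arrow ≫ q) := by
    refine ⟨?_, fun Z h hh => ?_⟩
    · rwa [← inf_kernelSubobject_eq_bot_iff, kernelSubobject_cokernel_arrow, inf_comm]
    · refine mono_of_kernelSubobject_comp_le q h ?_
      have hle : K ≤ kernelSubobject (q ≫ h) :=
        le_kernelSubobject _ _ (by simp [q])
      refine (hKmax ?_ hle).trans (kernelSubobject_cokernel_arrow K).ge
      rw [Category.assoc, ← inf_kernelSubobject_eq_bot_iff] at hh
      rwa [Set.mem_ofPred_eq, ← inf_kernelSubobject_eq_bot_iff, kernelSubobject_cokernel_arrow,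
        inf_comm]
  have := hq.mono
  -- The inclusion of `E` extends to an embedding of `I/K` into `I`. Its image is an essential
  -- extension of `N` containing `E`, so it equals `E`; this makes `E` a retract of `I`.
  let h := Injective.factorThru E.arrow (E.arrow ≫ q)
  have hh : (E.arrow ≫ q) ≫ h = E.arrow := Injective.comp_factorThru _ _
  have : Mono h := hq.mono_of_comp h (by rw [hh]; infer_instance)
  have hle : E ≤ Subobject.mk h := Subobject.le_mk_of_comm _ hh
  have hge : Subobject.mk h ≤ E := hE
    ⟨i ≫ (E.arrow ≫ q) ≫ (Subobject.underlyingIso h).inv,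
      hi.comp (hq.comp (IsEssential.of_isIso _)), by
        rw [Category.assoc, Category.assoc, Subobject.underlyingIso_arrow, hh, hik]⟩ hle
  let h' := Subobject.ofMkLE h E hge
  have hr : E.arrow ≫ q ≫ h' = 𝟙 _ := by
    rw [← cancel_mono E.arrow]
    simpa [h'] using hh
  exact ⟨E, Retract.injective ⟨E.arrow, q ≫ h', hr⟩, i, E.arrow, hi, hik⟩

/-! ### Uniform objects and indecomposable injectives. -/

/-- A nonzero object is uniform if the kernels of two morphisms out of it meet trivially only if
one of them is zero. -/
structure IsUniform (X : C) : Prop where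
  not_isZero : ¬ IsZero X
  mono_or_mono : ∀ ⦃Y Z : C⦄ (g : X ⟶ Y) (h : X ⟶ Z), Mono (biprod.lift g h) → Mono g ∨ Mono h

lemma IsUniform.of_isEssential {X Y : C} {i : X ⟶ Y} (hX : IsUniform X) (hi : IsEssential i) :
    IsUniform Y where
  not_isZero hY := by
    have := hi.mono
    exact hX.not_isZero (IsZero.of_mono i hY)
  mono_or_mono Z W g h hgh := by
    have := hi.mono
    have : i ≫ biprod.lift g h = biprod.lift (i ≫ g) (i ≫ h) := by ext <;> simp
    exact (hX.mono_or_mono (i ≫ g) (i ≫ h) (by rw [← this]; infer_instance)).imp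
      (hi.mono_of_comp g) (hi.mono_of_comp h)

/-- The two projections of a decomposition are jointly monic, so one of them is monic and the other
summand vanishes. -/
lemma IsUniform.indecomposable {X : C} (hX : IsUniform X) : Indecomposable X := by
  refine ⟨hX.not_isZero, fun Y Z e => ?_⟩
  rcases hX.mono_or_mono (e.hom ≫ biprod.fst) (e.hom ≫ biprod.snd) (by
    have : biprod.lift (e.hom ≫ biprod.fst) (e.hom ≫ biprod.snd) = e.hom := by ext <;> simp
    rw [this]
    infer_instance) with h | h
  · refine Or.inr ((IsZero.iff_id_eq_zero _).2 ?_)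
    have : (biprod.inr ≫ e.inv) ≫ e.hom ≫ biprod.fst = (0 : Z ⟶ Y) := by simp
    have := zero_of_comp_mono _ this
    simpa using this =≫ (e.hom ≫ biprod.snd)
  · refine Or.inl ((IsZero.iff_id_eq_zero _).2 ?_)
    have : (biprod.inl ≫ e.inv) ≫ e.hom ≫ biprod.snd = (0 : Y ⟶ Z) := by simp
    have := zero_of_comp_mono _ this
    simpa using this =≫ (e.hom ≫ biprod.fst)

/-- An injective hull of `N` inside `E` is a nonzero direct summand, hence all of `E`. -/
lemma isEssential_of_indecomposable {E N : C} [Injective E] (hE : Indecomposable E) (k : N ⟶ E)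
    [Mono k] (hN : ¬ IsZero N) : IsEssential k := by
  obtain ⟨F, _, i, j, hi, rfl⟩ := exists_injective_hull k
  have := hi.mono
  have : Mono j := hi.mono_of_comp j inferInstance
  have : IsSplitMono j := ⟨⟨⟨Injective.factorThru (𝟙 F) j, Injective.comp_factorThru _ _⟩⟩⟩
  let b := isBilimitBinaryBiconeOfIsSplitMonoOfCokernel (cokernelIsCokernel j)
  rcases hE.2 _ _ (biprod.uniqueUpToIso _ _ b) with h | h
  · exact (hN (IsZero.of_mono i h)).elim
  · have : Epi j := Preadditive.epi_of_cokernel_zero (h.eq_of_tgt _ _)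
    have : IsIso j := isIso_of_mono_of_epi j
    exact hi.comp (IsEssential.of_isIso j)

lemma IsUniform.of_indecomposable {E : C} [Injective E] (hE : Indecomposable E) :
    IsUniform E where
  not_isZero := hE.1
  mono_or_mono Y Z g h hgh := by
    by_contra! H
    have hK : ¬ IsZero (kernel g) := fun hK =>
      H.1 (Preadditive.mono_of_kernel_zero (hK.eq_of_src _ _))
    refine H.2 ((isEssential_of_indecomposable hE (kernel.ι g) hK).mono_of_comp h ?_)
    refine Preadditive.mono_of_cancel_zero _ fun {W} z hz => ?_
    have : (z ≫ kernel.ι g) ≫ biprod.lift g h = 0 := by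
      ext <;> simp [hz]
    exact zero_of_comp_mono _ (zero_of_comp_mono _ this)

/-- A uniform object has an indecomposable injective hull. -/
lemma IsUniform.exists_indecomposable_hull {N : C} (hN : IsUniform N) :
    ∃ (E : C) (_ : Injective E) (_ : Indecomposable E) (i : N ⟶ E), IsEssential i := by
  obtain ⟨F, hF, i, -, hi, -⟩ := exists_injective_hull (Injective.ι N)
  exact ⟨F, hF, (hN.of_isEssential hi).indecomposable, i, hi⟩

end Directed

/-! ### Torsion-free objects -/

namespace LocalizingSubcategory

variable {L : LocalizingSubcategory C}

lemma isTorsionFree_iff {Y : C} :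
    L.IsTorsionFree Y ↔ ∀ ⦃T : C⦄, L.prop T → ∀ f : T ⟶ Y, f = 0 := by
  constructor
  · intro h T hT f
    have := h (imageSubobject f) (L.prop.prop_of_epi (factorThruImageSubobject f) hT)
    rw [← imageSubobject_arrow_comp f, (isZero_of_subobject_eq_bot this).eq_of_src
      (imageSubobject f).arrow 0, comp_zero]
  · intro h S hS
    rw [← Subobject.mk_arrow S, Subobject.mk_eq_bot_iff_zero]
    exact h hS _

namespace IsTorsionFree

lemma eq_zero {T Y : C} (hY : L.IsTorsionFree Y) (hT : L.prop T) (f : T ⟶ Y) : f = 0 :=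
  isTorsionFree_iff.1 hY hT f

lemma of_mono {X Y : C} (i : X ⟶ Y) [Mono i] (hY : L.IsTorsionFree Y) : L.IsTorsionFree X :=
  isTorsionFree_iff.2 fun _ hT _ => zero_of_comp_mono i (hY.eq_zero hT _)

lemma of_isZero {X : C} (hX : IsZero X) : L.IsTorsionFree X :=
  isTorsionFree_iff.2 fun _ _ _ => hX.eq_of_tgt _ _

lemma biprod {X Y : C} (hX : L.IsTorsionFree X) (hY : L.IsTorsionFree Y) :
    L.IsTorsionFree (X ⊞ Y) :=
  isTorsionFree_iff.2 fun _ hT f => by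
    ext
    · simp [hX.eq_zero hT (f ≫ biprod.fst)]
    · simp [hY.eq_zero hT (f ≫ biprod.snd)]

lemma product {ι : Type v} {E : ι → C} [HasProduct E] (hE : ∀ i, L.IsTorsionFree (E i)) :
    L.IsTorsionFree (∏ᶜ E) :=
  isTorsionFree_iff.2 fun _ hT f => by
    ext i
    simp [(hE i).eq_zero hT (f ≫ Pi.π E i)]

lemma of_le {L' : LocalizingSubcategory C} (h : L ≤ L') {Y : C} (hY : L'.IsTorsionFree Y) :
    L.IsTorsionFree Y :=
  fun S hS => hY S (h _ hS)

lemma of_isEssential {X Y : C} {i : X ⟶ Y} (hi : IsEssential i) (hX : L.IsTorsionFree X) :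
    L.IsTorsionFree Y := by
  have := hi.mono
  intro S hS
  refine (isEssential_iff i).1 hi S (subobject_eq_bot_of_isZero ?_)
  have h₁ := L.prop.prop_of_mono (Subobject.ofLE _ _ (inf_le_left : S ⊓ Subobject.mk i ≤ S)) hS
  have h₂ := Subobject.inf_arrow_factors_right S (Subobject.mk i)
  rw [Subobject.mk_factors_iff] at h₂
  obtain ⟨k, hk⟩ := h₂
  refine (IsZero.iff_id_eq_zero _).2 ?_
  rw [← cancel_mono (S ⊓ Subobject.mk i).arrow, Category.id_comp, ← hk]
  have : k = 0 := hX.eq_zero h₁ k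
  rw [this, zero_comp, comp_zero]

/-- Morphisms to a torsion-free injective object extend along morphisms with torsion kernel. -/
lemma exists_extension {X Y E : C} [Injective E] (hE : L.IsTorsionFree E) {s : X ⟶ Y}
    (hs : L.prop.monoModSerre s) (f : X ⟶ E) : ∃ f' : Y ⟶ E, s ≫ f' = f :=
  ⟨(ShortComplex.exact_kernel s).descToInjective f (hE.eq_zero hs _),
    (ShortComplex.exact_kernel s).comp_descToInjective _ _⟩

end IsTorsionFree

lemma monoModSerre_biprod_map {X X' Y Y' : C} {f : X ⟶ X'} {g : Y ⟶ Y'}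
    (hf : L.prop.monoModSerre f) (hg : L.prop.monoModSerre g) :
    L.prop.monoModSerre (biprod.map f g) := by
  let a : kernel (biprod.map f g) ⟶ kernel f := kernel.lift f (kernel.ι _ ≫ biprod.fst) (by
    rw [Category.assoc, ← biprod.map_fst, kernel.condition_assoc, zero_comp])
  let b : kernel (biprod.map f g) ⟶ kernel g := kernel.lift g (kernel.ι _ ≫ biprod.snd) (by
    rw [Category.assoc, ← biprod.map_snd, kernel.condition_assoc, zero_comp])
  have h : biprod.lift a b ≫ biprod.map (kernel.ι f) (kernel.ι g) =
      kernel.ι (biprod.map f g) := by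
    ext <;> simp [a, b]
  have : Mono (biprod.lift a b) := by
    have : Mono (biprod.lift a b ≫ biprod.map (kernel.ι f) (kernel.ι g)) := by
      rw [h]
      infer_instance
    exact mono_of_mono _ (biprod.map (kernel.ι f) (kernel.ι g))
  exact L.prop.prop_of_mono (biprod.lift a b) (L.prop.prop_biprod hf hg)

variable (C) in
/-- The localizing subcategory of zero objects. -/
def zeroObjects : LocalizingSubcategory C where
  prop X := IsZero X
  isLocalizing :=
    { isSerreClass := inferInstanceAs (ObjectProperty.IsSerreClass (IsZero (C := C)))
      coproducts ι := ⟨by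
        rintro X ⟨h⟩
        exact (IsZero.iff_id_eq_zero _).2 (h.isColimit.hom_ext fun j =>
          (h.prop_diag_obj j).eq_of_src _ _)⟩ }

/-- Statements about kernels lying in `L` become, for `L = ⊥`, statements about monomorphisms; they
are used in this form to embed noetherian objects into finite sums of `E_x`. -/
lemma isZero_of_prop_bot {X : C} (hX : (⊥ : LocalizingSubcategory C).prop X) : IsZero X :=
  (bot_le : ⊥ ≤ zeroObjects C) X hX

lemma isTorsionFree_bot (X : C) : (⊥ : LocalizingSubcategory C).IsTorsionFree X :=
  fun _ hS => subobject_eq_bot_of_isZero (isZero_of_prop_bot hS)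

lemma mono_of_monoModSerre_bot {X Y : C} {f : X ⟶ Y}
    (hf : (⊥ : LocalizingSubcategory C).prop.monoModSerre f) : Mono f :=
  Preadditive.mono_of_kernel_zero ((isZero_of_prop_bot hf).eq_of_src _ _)

end LocalizingSubcategory

/-! ### Finite sums of indecomposable injectives -/

/-- The finite direct sums of objects satisfying `P`. -/
inductive IsFiniteSum (P : ObjectProperty C) : C → Prop
  | of_isZero {X : C} (_ : IsZero X) : IsFiniteSum P X
  | of {X : C} (hX : P X) : IsFiniteSum P X
  | biprod {X Y : C} (hX : IsFiniteSum P X) (hY : IsFiniteSum P Y) : IsFiniteSum P (X ⊞ Y)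

lemma kernelSubobject_lt_of_not_mono {X Y Z : C} (q : X ⟶ Y) [Epi q] (h : Y ⟶ Z) (hh : ¬ Mono h) :
    kernelSubobject q < kernelSubobject (q ≫ h) :=
  lt_of_le_not_ge (kernelSubobject_comp_le q h)
    fun hle => hh (mono_of_kernelSubobject_comp_le q h hle)

/-- Noetherian induction on the quotients of a noetherian object. -/
lemma noetherian_induction {P : C → Prop}
    (hP : ∀ M : C, (∀ (M' : C) (q : M ⟶ M'), Epi q → ¬ Mono q → P M') → P M)
    (N : C) [IsNoetherianObject N] (M : C) (q : N ⟶ M) [Epi q] : P M := by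
  -- The induction runs on the kernel of `N ⟶ M`, which grows strictly when `M` is replaced by a
  -- proper quotient.
  have key : ∀ (K : Subobject N) (M : C) (q : N ⟶ M), Epi q → kernelSubobject q = K → P M := by
    intro K
    induction K using WellFoundedGT.induction with
    | ind K ih =>
      intro M q _ hK
      refine hP M fun M' q' _ hq' => ih _ ?_ M' (q ≫ q') inferInstance rfl
      rw [← hK]
      exact kernelSubobject_lt_of_not_mono q q' hq'
  exact key _ M q inferInstance rfl

namespace InjectiveSpectrum

lemma rep_indecomposable (x : InjectiveSpectrum C) : Indecomposable x.rep := (Quotient.out x).2.2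

lemma exists_rep_iso (E : C) [Injective E] (hE : Indecomposable E) :
    ∃ x : InjectiveSpectrum C, Nonempty (E ≅ x.rep) := by
  let E' : IndecomposableInjective C := ⟨E, inferInstance, hE⟩
  refine ⟨Quotient.mk _ E', ?_⟩
  obtain ⟨e⟩ := Quotient.exact (Quotient.out_eq (Quotient.mk (indecomposableInjectiveSetoid C) E'))
  exact ⟨e.symm⟩

end InjectiveSpectrum

open InjectiveSpectrum

/-- The chosen representatives of the `L`-torsion-free indecomposable injectives. -/
def torsionFreeReps (L : LocalizingSubcategory C) : ObjectProperty C :=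
  fun E => ∃ x ∈ torsionFreeLocus L, E = x.rep

section Grothendieck

variable [IsGrothendieckAbelian.{v} C]

/-- By noetherian induction on quotients. A nonzero torsion subobject can be divided out; a
torsion-free uniform object embeds in its hull, which is some torsion-free `E_x`; any other nonzero
torsion-free object embeds in the sum of two proper quotients. -/
lemma exists_monoModSerre_isFiniteSum (L : LocalizingSubcategory C) (N : C) [IsNoetherianObject N]
    (M : C) (q : N ⟶ M) [Epi q] :
    ∃ (Q : C) (h : M ⟶ Q), IsFiniteSum (torsionFreeReps L) Q ∧ L.prop.monoModSerre h := by
  refine noetherian_induction (P := fun M => ∃ (Q : C) (h : M ⟶ Q),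
    IsFiniteSum (torsionFreeReps L) Q ∧ L.prop.monoModSerre h) (fun M ih => ?_) N M q
  by_cases hM : L.IsTorsionFree M
  · by_cases hM₀ : IsZero M
    · exact ⟨M, 𝟙 M, .of_isZero hM₀, L.prop.monoModSerre_of_mono _⟩
    · by_cases hMu : IsUniform M
      · obtain ⟨E, _, hE, i, hi⟩ := hMu.exists_indecomposable_hull
        obtain ⟨x, ⟨e⟩⟩ := exists_rep_iso E hE
        have := hi.mono
        refine ⟨_, i ≫ e.hom, .of ⟨x, ?_, rfl⟩, L.prop.monoModSerre_of_mono _⟩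
        exact (hM.of_isEssential hi).of_mono e.inv
      · have : ∃ (Y Z : C) (g : M ⟶ Y) (h : M ⟶ Z), Mono (biprod.lift g h) ∧ ¬ Mono g ∧ ¬ Mono h := by
          by_contra! H
          exact hMu ⟨hM₀, fun Y Z g h hgh => or_iff_not_imp_left.2 (H Y Z g h hgh)⟩
        obtain ⟨Y, Z, g, h, hgh, hg, hh⟩ := this
        -- The induction hypothesis concerns quotients of `M`, so `g` and `h` are replaced by the
        -- projections onto their images.
        have mono_image {W : C} {f : M ⟶ W} (hf : ¬ Mono f) :
            ¬ Mono (Abelian.factorThruImage f) := fun _ => hf (by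
          rw [← Abelian.image.fac f]
          infer_instance)
        obtain ⟨Q₁, a, hQ₁, ha⟩ := ih _ (Abelian.factorThruImage g) inferInstance (mono_image hg)
        obtain ⟨Q₂, b, hQ₂, hb⟩ := ih _ (Abelian.factorThruImage h) inferInstance (mono_image hh)
        have : Mono (biprod.lift (Abelian.factorThruImage g) (Abelian.factorThruImage h)) := by
          have : biprod.lift g h = biprod.lift (Abelian.factorThruImage g)
              (Abelian.factorThruImage h) ≫ biprod.map (Abelian.image.ι g) (Abelian.image.ι h) := by
            ext <;> simp
          rw [this] at hgh
          exact mono_of_mono _ (biprod.map (Abelian.image.ι g) (Abelian.image.ι h))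
        exact ⟨_, _, .biprod hQ₁ hQ₂, L.prop.monoModSerre.comp_mem
          (biprod.lift (Abelian.factorThruImage g) (Abelian.factorThruImage h)) _
          (L.prop.monoModSerre_of_mono _) (LocalizingSubcategory.monoModSerre_biprod_map ha hb)⟩
  · obtain ⟨S, hS, hS₀⟩ : ∃ S : Subobject M, L.prop (S : C) ∧ S ≠ ⊥ := by
      simpa [LocalizingSubcategory.IsTorsionFree] using hM
    obtain ⟨Q, h, hQ, hh⟩ := ih _ (cokernel.π S.arrow) inferInstance (by
      rw [← kernelSubobject_eq_bot_iff, kernelSubobject_cokernel_arrow]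
      exact hS₀)
    refine ⟨Q, _, hQ, L.prop.monoModSerre.comp_mem (cokernel.π S.arrow) h ?_ hh⟩
    refine L.prop.prop_of_iso ?_ hS
    exact eqToIso (by rw [kernelSubobject_cokernel_arrow]) ≪≫ kernelSubobjectIso _

lemma hom_ext_of_isNoetherianObject (hC : IsLocallyNoetherianCategory C) {X Y : C} {f g : X ⟶ Y}
    (h : ∀ (N : C) [IsNoetherianObject N] (n : N ⟶ X), n ≫ f = n ≫ g) : f = g := by
  obtain ⟨P, -, hP, hP'⟩ := hC
  refine hP' f g fun N hN n => ?_
  have := hP N hN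
  exact h N n

lemma IsFiniteSum.eq_zero {P : ObjectProperty C} {X Q : C} (hQ : IsFiniteSum P Q)
    (h : ∀ E, P E → ∀ f : X ⟶ E, f = 0) (f : X ⟶ Q) : f = 0 := by
  induction hQ with
  | of_isZero hX => exact hX.eq_of_tgt _ _
  | of hX => exact h _ hX f
  | biprod _ _ h₁ h₂ =>
    ext
    · simp [h₁ (f ≫ biprod.fst)]
    · simp [h₂ (f ≫ biprod.snd)]

/-- An object lies in `L` if all images of noetherian objects in it lie in `L`. -/
lemma prop_of_forall_noetherian (hC : IsLocallyNoetherianCategory C) (L : LocalizingSubcategory C)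
    {X : C} (h : ∀ (N : C) [IsNoetherianObject N] (n : N ⟶ X),
      L.prop (imageSubobject n : C)) : L.prop X := by
  -- The direct sum of all subobjects of `X` lying in `L` maps onto `X`, since morphisms out of `X`
  -- are detected on noetherian images.
  let ι := {S : Subobject X // L.prop (S : C)}
  let F : Shrink.{v} ι → C := fun j => (((equivShrink ι).symm j).1 : C)
  let p : ∐ F ⟶ X := Sigma.desc fun j => ((equivShrink ι).symm j).1.arrow
  have hp : Epi p := by
    refine ⟨fun f g hfg => hom_ext_of_isNoetherianObject hC fun N _ n => ?_⟩
    have hS (S : ι) : S.1.arrow ≫ f = S.1.arrow ≫ g := by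
      obtain ⟨j, rfl⟩ := (equivShrink ι).symm.surjective S
      simpa [p] using Sigma.ι F j ≫= hfg
    rw [← imageSubobject_arrow_comp n, Category.assoc, hS ⟨_, h N n⟩, Category.assoc]
  have := L.isLocalizing.coproducts (Shrink.{v} ι)
  exact L.prop.prop_of_epi p (L.prop.prop_colimit _ fun j => ((equivShrink ι).symm j.as).2)

/-- If `X` has no nonzero morphism to a torsion-free `E_x`, neither has any noetherian image in `X`.
Its morphism to a finite sum of such `E_x` with kernel in `L` is then zero, so the image itself lies
in `L`. -/
theorem localizingOf_torsionFreeLocus (hC : IsLocallyNoetherianCategory C)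
    (L : LocalizingSubcategory C) : localizingOf (torsionFreeLocus L) = L := by
  refine le_antisymm (fun X hX => ?_) fun X hX x hx f => hx.eq_zero hX f
  refine prop_of_forall_noetherian hC L fun N _ n => ?_
  obtain ⟨Q, h, hQ, hh⟩ := exists_monoModSerre_isFiniteSum L N _ (factorThruImageSubobject n)
  have h₀ : h = 0 := by
    refine hQ.eq_zero ?_ h
    rintro _ ⟨x, hx, rfl⟩ f
    exact (localizingOf (torsionFreeLocus L)).prop.prop_of_mono (imageSubobject n).arrow hX x hx f
  rwa [h₀, L.prop.monoModSerre_zero_iff] at hh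

/-! ### Stable localizing subcategories -/

/-- A nonzero subobject of `E_x` in `L` is essential, so stability puts `E_x` itself in `L`. -/
lemma prop_or_isTorsionFree_rep {L : LocalizingSubcategory C} (hL : L.IsStable)
    (x : InjectiveSpectrum C) : L.prop x.rep ∨ L.IsTorsionFree x.rep := by
  by_contra! H
  obtain ⟨S, hS, hS₀⟩ : ∃ S : Subobject x.rep, L.prop (S : C) ∧ S ≠ ⊥ := by
    simpa [LocalizingSubcategory.IsTorsionFree] using H.2
  exact H.1 (hL S.arrow ((isEssential_iff _).1 (isEssential_of_indecomposable x.rep_indecomposable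
    S.arrow fun h => hS₀ (subobject_eq_bot_of_isZero h))) hS)

-- The summands are sorted into torsion and torsion-free ones. A jointly monic pair suffices for the
-- stability criterion and passes to sums without rearranging them.
open ZeroObject in
lemma IsFiniteSum.exists_torsion_torsionFree {L : LocalizingSubcategory C}
    {P : ObjectProperty C} (hP : ∀ E, P E → L.prop E ∨ L.IsTorsionFree E) {Q : C}
    (hQ : IsFiniteSum P Q) :
    ∃ (T F : C) (t : Q ⟶ T) (f : Q ⟶ F), L.prop T ∧ L.IsTorsionFree F ∧ Mono (biprod.lift t f) := by
  induction hQ with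
  | @of_isZero X hX =>
    exact ⟨X, X, 𝟙 X, 𝟙 X, L.prop.prop_of_isZero hX, .of_isZero hX,
      ⟨fun _ _ _ => hX.eq_of_tgt _ _⟩⟩
  | @of X hX =>
    rcases hP X hX with hX | hX
    · exact ⟨X, 0, 𝟙 X, 0, hX, .of_isZero (isZero_zero C), mono_of_mono_fac (biprod.lift_fst _ _)⟩
    · exact ⟨0, X, 0, 𝟙 X, L.prop.prop_zero, hX, mono_of_mono_fac (biprod.lift_snd _ _)⟩
  | @biprod X Y _ _ h₁ h₂ =>
    obtain ⟨T₁, F₁, t₁, f₁, hT₁, hF₁, _⟩ := h₁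
    obtain ⟨T₂, F₂, t₂, f₂, hT₂, hF₂, _⟩ := h₂
    refine ⟨T₁ ⊞ T₂, F₁ ⊞ F₂, biprod.map t₁ t₂, biprod.map f₁ f₂, L.prop.prop_biprod hT₁ hT₂,
      hF₁.biprod hF₂, Preadditive.mono_of_cancel_zero _ fun {W} z hz => ?_⟩
    have ht := hz =≫ biprod.fst
    have hf := hz =≫ biprod.snd
    simp only [Category.assoc, biprod.lift_fst, biprod.lift_snd, zero_comp] at ht hf
    ext
    · rw [zero_comp, ← cancel_mono (biprod.lift t₁ f₁)]
      ext
      · simpa using ht =≫ biprod.fst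
      · simpa using hf =≫ biprod.fst
    · rw [zero_comp, ← cancel_mono (biprod.lift t₂ f₂)]
      ext
      · simpa using ht =≫ biprod.snd
      · simpa using hf =≫ biprod.snd

/-- A localizing subcategory is stable if every indecomposable injective is torsion or
torsion-free. -/
theorem isStable_of_prop_or_isTorsionFree_rep (hC : IsLocallyNoetherianCategory C)
    {L : LocalizingSubcategory C}
    (hL : ∀ x : InjectiveSpectrum C, L.prop x.rep ∨ L.IsTorsionFree x.rep) : L.IsStable := by
  intro X Y f _ hf hX
  rw [← localizingOf_torsionFreeLocus hC L]
  intro x hx g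
  refine hom_ext_of_isNoetherianObject hC fun N _ n => ?_
  let m := (imageSubobject n).arrow
  suffices hI : L.prop (imageSubobject n : C) by
    rw [← imageSubobject_arrow_comp n, Category.assoc, hx.eq_zero hI (_ ≫ g), comp_zero, comp_zero]
  -- With `⊥` in place of `L`, the noetherian image embeds in a finite sum of `E_x`, hence in `T ⊞
  -- F` with `T` torsion and `F` torsion-free.
  obtain ⟨Q, h, hQ, hh⟩ := exists_monoModSerre_isFiniteSum (⊥ : LocalizingSubcategory C) N _
    (factorThruImageSubobject n)
  have : Mono h := LocalizingSubcategory.mono_of_monoModSerre_bot hh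
  obtain ⟨T, F, t, f', hT, hF, _⟩ := hQ.exists_torsion_torsionFree (L := L) (by
    rintro _ ⟨x, -, rfl⟩
    exact hL x)
  -- The kernel of the component to `T` embeds in `F`, so its intersection with the torsion object
  -- `X` is zero; since `X` is essential in `Y`, the kernel is zero.
  suffices Mono (h ≫ t) from L.prop.prop_of_mono (h ≫ t) hT
  refine Preadditive.mono_of_kernel_zero ?_
  let k := kernel.ι (h ≫ t)
  have hS := hf (Subobject.mk (k ≫ m)) (subobject_eq_bot_of_isZero ?_)
  · rw [Subobject.mk_eq_bot_iff_zero] at hS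
    exact zero_of_comp_mono m hS
  · let S := Subobject.mk (k ≫ m) ⊓ Subobject.mk f
    have h₁ := Subobject.inf_arrow_factors_left (Subobject.mk (k ≫ m)) (Subobject.mk f)
    have h₂ := Subobject.inf_arrow_factors_right (Subobject.mk (k ≫ m)) (Subobject.mk f)
    obtain ⟨a, ha⟩ : ∃ a : (S : C) ⟶ kernel (h ≫ t), a ≫ k ≫ m = S.arrow :=
      (Subobject.mk_factors_iff _ _).1 h₁
    obtain ⟨b, hb⟩ : ∃ b : (S : C) ⟶ X, b ≫ f = S.arrow := (Subobject.mk_factors_iff _ _).1 h₂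
    have : Mono b := mono_of_mono_fac hb
    have hS := L.prop.prop_of_mono b hX
    have hak : (a ≫ k) ≫ h ≫ biprod.lift t f' = 0 := by
      ext
      · simp [k, kernel.condition]
      · simpa using hF.eq_zero hS _
    have := zero_of_comp_mono _ hak
    refine (IsZero.iff_id_eq_zero _).2 ?_
    rw [← cancel_mono S.arrow, Category.id_comp, zero_comp, ← ha, reassoc_of% this, zero_comp]

/-! ### Torsion-free loci and the stable topology. -/

lemma mem_torsionFreeLocus_iff {L : LocalizingSubcategory C} {x : InjectiveSpectrum C} :
    x ∈ torsionFreeLocus L ↔ L ≤ localizingOf {x} := by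
  refine LocalizingSubcategory.isTorsionFree_iff.trans ⟨?_, ?_⟩
  · rintro h X hX _ rfl
    exact h hX
  · exact fun h T hT => h T hT x rfl

lemma torsionFreeLocus_sup (L L' : LocalizingSubcategory C) :
    torsionFreeLocus (L ⊔ L') = torsionFreeLocus L ∩ torsionFreeLocus L' := by
  ext x
  simp only [mem_torsionFreeLocus_iff, sup_le_iff, Set.mem_inter_iff]

lemma torsionFreeLocus_antitone {L L' : LocalizingSubcategory C} (h : L ≤ L') :
    torsionFreeLocus L' ⊆ torsionFreeLocus L :=
  fun _ hx => hx.of_le h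

lemma isStable_sup (hC : IsLocallyNoetherianCategory C) {L L' : LocalizingSubcategory C}
    (hL : L.IsStable) (hL' : L'.IsStable) : (L ⊔ L').IsStable := by
  refine isStable_of_prop_or_isTorsionFree_rep hC fun x => ?_
  rcases prop_or_isTorsionFree_rep hL x with h | h
  · exact Or.inl ((le_sup_left : L ≤ L ⊔ L') _ h)
  · rcases prop_or_isTorsionFree_rep hL' x with h' | h'
    · exact Or.inl ((le_sup_right : L' ≤ L ⊔ L') _ h')
    · refine Or.inr ?_
      change x ∈ torsionFreeLocus (L ⊔ L')
      rw [torsionFreeLocus_sup]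
      exact ⟨h, h'⟩

lemma prop_iInf_iff {ι : Type w} (L : ι → LocalizingSubcategory C) (X : C) :
    (⨅ i, L i).prop X ↔ ∀ i, (L i).prop X := by
  refine ⟨fun h i => iInf_le L i X h, fun h => ?_⟩
  rintro _ ⟨i, rfl⟩
  exact h i

lemma isStable_iInf {ι : Type w} {L : ι → LocalizingSubcategory C} (hL : ∀ i, (L i).IsStable) :
    (⨅ i, L i).IsStable := by
  intro X Y f _ hf hX
  rw [prop_iInf_iff] at hX ⊢
  exact fun i => hL i f hf (hX i)

/-- If `E_x` is torsion-free for no `L i`, the dichotomy puts it in every `L i`, hence in the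
intersection; being nonzero, it is then not torsion-free for the intersection. -/
lemma torsionFreeLocus_iInf {ι : Type w} {L : ι → LocalizingSubcategory C}
    (hL : ∀ i, (L i).IsStable) : torsionFreeLocus (⨅ i, L i) = ⋃ i, torsionFreeLocus (L i) := by
  refine subset_antisymm (fun x hx => ?_)
    (Set.iUnion_subset fun i => torsionFreeLocus_antitone (iInf_le L i))
  by_contra! h
  rw [Set.mem_iUnion, not_exists] at h
  have h' : (⨅ i, L i).prop x.rep :=
    (prop_iInf_iff _ _).2 fun i => (prop_or_isTorsionFree_rep (hL i) x).resolve_right (h i)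
  exact x.rep_indecomposable.1 ((IsZero.iff_id_eq_zero _).2 (hx.eq_zero h' _))

/-- The generating family is already a topology: suprema give intersections, intersections of
subcategories give unions, and `⊥` gives the whole space. -/
theorem isOpen_iff_isStableSubset (hC : IsLocallyNoetherianCategory C)
    (A : Set (InjectiveSpectrum C)) : IsOpen A ↔ IsStableSubset A := by
  refine ⟨fun h => ?_, fun h => .basic _ h⟩
  induction h with
  | basic A hA => exact hA
  | univ =>
    refine ⟨⊥, isStable_of_prop_or_isTorsionFree_rep hC fun x =>
      Or.inr (LocalizingSubcategory.isTorsionFree_bot _), ?_⟩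
    exact Set.eq_univ_of_forall fun x => LocalizingSubcategory.isTorsionFree_bot _
  | inter A B _ _ hA hB =>
    obtain ⟨L, hL, rfl⟩ := hA
    obtain ⟨L', hL', rfl⟩ := hB
    exact ⟨L ⊔ L', isStable_sup hC hL hL', torsionFreeLocus_sup L L'⟩
  | sUnion S _ hS =>
    choose L hL hLS using fun A : S => hS A.1 A.2
    exact ⟨⨅ i, L i, isStable_iInf hL, by
      rw [torsionFreeLocus_iInf hL, Set.sUnion_eq_iUnion]
      exact Set.iUnion_congr hLS⟩

theorem isStable_and_torsionFreeLocus_eq_iff (hC : IsLocallyNoetherianCategory C)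
    {A : Set (InjectiveSpectrum C)} (hA : IsStableSubset A) (L : LocalizingSubcategory C) :
    (L.IsStable ∧ torsionFreeLocus L = A) ↔ L = localizingOf A := by
  obtain ⟨L', hL', rfl⟩ := hA
  rw [localizingOf_torsionFreeLocus hC]
  constructor
  · rintro ⟨-, h⟩
    rw [← localizingOf_torsionFreeLocus hC L, h, localizingOf_torsionFreeLocus hC]
  · rintro rfl
    exact ⟨hL', rfl⟩

end Grothendieck

open InjectiveSpectrum LocalizingSubcategory ObjectProperty.SerreClassLocalization

/-! ### Morphisms in the quotient category -/

section Quotient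

variable {L : LocalizingSubcategory C}

lemma LocalizingSubcategory.IsTorsionFree.quotFunctor_map_injective {X E : C}
    (hE : L.IsTorsionFree E) {f g : X ⟶ E} (h : L.quotFunctor.map f = L.quotFunctor.map g) :
    f = g := by
  rw [← sub_eq_zero, ← Functor.map_sub, map_eq_zero_iff _ L.prop] at h
  rw [← sub_eq_zero, ← Abelian.image.fac (f - g), hE.eq_zero h (Abelian.image.ι (f - g)), comp_zero]

/-- A morphism of `C/L` is a right fraction, and its numerator extends along the denominator because
the latter has torsion kernel and `E` is torsion-free injective. -/
lemma LocalizingSubcategory.IsTorsionFree.quotFunctor_map_surjective {X E : C} [Injective E]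
    (hE : L.IsTorsionFree E) (g : L.quotFunctor.obj X ⟶ L.quotFunctor.obj E) :
    ∃ f : X ⟶ E, L.quotFunctor.map f = g := by
  obtain ⟨φ, hφ⟩ := Localization.exists_rightFraction L.quotFunctor L.prop.isoModSerre g
  obtain ⟨f, hf⟩ := hE.exists_extension φ.hs.1 φ.f
  have := Localization.inverts L.quotFunctor L.prop.isoModSerre _ φ.hs
  refine ⟨f, ?_⟩
  rw [← cancel_epi (L.quotFunctor.map φ.s), ← Functor.map_comp, hf, hφ,
    MorphismProperty.RightFraction.map_s_comp_map]

end Quotient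

section Grothendieck

variable [IsGrothendieckAbelian.{v} C]

/-- Every object maps to a product of torsion-free indecomposable injectives with torsion kernel. -/
lemma exists_monoModSerre_product (hC : IsLocallyNoetherianCategory C)
    (L : LocalizingSubcategory C) (X : C) :
    ∃ (ι : Type v) (x : ι → InjectiveSpectrum C) (_ : ∀ i, x i ∈ torsionFreeLocus L)
      (j : X ⟶ ∏ᶜ fun i => (x i).rep), L.prop.monoModSerre j := by
  -- Each subobject not in `L` is given a morphism from `X` to a torsion-free `E_x` that does not
  -- vanish on it. The common kernel of these morphisms must then lie in `L`.
  let κ := {S : Subobject X // ¬ L.prop (S : C)}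
  have h (S : κ) : ∃ x ∈ torsionFreeLocus L, ∃ f : X ⟶ x.rep, S.1.arrow ≫ f ≠ 0 := by
    have hS : ¬ (localizingOf (torsionFreeLocus L)).prop (S.1 : C) :=
      fun h => S.2 ((localizingOf_torsionFreeLocus hC L).le _ h)
    change ¬ ∀ x ∈ torsionFreeLocus L, ∀ f : (S.1 : C) ⟶ x.rep, f = 0 at hS
    push Not at hS
    obtain ⟨x, hx, f, hf⟩ := hS
    exact ⟨x, hx, Injective.factorThru f S.1.arrow, by rwa [Injective.comp_factorThru]⟩
  choose x hx f hf using h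
  let e := (equivShrink.{v} κ).symm
  refine ⟨Shrink.{v} κ, fun i => x (e i), fun i => hx _, Pi.lift fun i => f (e i), ?_⟩
  by_contra hK
  let j : X ⟶ ∏ᶜ fun i => (x (e i)).rep := Pi.lift fun i => f (e i)
  have hS : ¬ L.prop (Subobject.mk (kernel.ι j) : C) := fun h =>
    hK (L.prop.prop_of_iso (Subobject.underlyingIso _) h)
  let i := e.symm ⟨_, hS⟩
  have hi : e i = ⟨_, hS⟩ := e.apply_symm_apply _
  apply hf ⟨_, hS⟩
  rw [← hi]
  have : f (e i) = j ≫ Pi.π _ i := by simp [j]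
  have h₀ : (e i).1.arrow ≫ j = 0 := by
    rw [hi, ← Subobject.underlyingIso_hom_comp_eq_mk, Category.assoc, kernel.condition, comp_zero]
  rw [this, reassoc_of% h₀, zero_comp]

/-- The morphisms to the torsion-free indecomposable injectives are jointly faithful on the
quotient category. -/
lemma quotFunctor_hom_ext (hC : IsLocallyNoetherianCategory C) (L : LocalizingSubcategory C)
    {X Y : C} {a b : L.quotFunctor.obj X ⟶ L.quotFunctor.obj Y}
    (h : ∀ x ∈ torsionFreeLocus L, ∀ f : Y ⟶ x.rep,
      a ≫ L.quotFunctor.map f = b ≫ L.quotFunctor.map f) : a = b := by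
  obtain ⟨ι, x, hx, j, hj⟩ := exists_monoModSerre_product hC L Y
  have : Mono (L.quotFunctor.map j) := (mono_map_iff _ L.prop j).2 hj
  have hP : L.IsTorsionFree (∏ᶜ fun i => (x i).rep) := IsTorsionFree.product hx
  obtain ⟨a', ha⟩ := hP.quotFunctor_map_surjective (a ≫ L.quotFunctor.map j)
  obtain ⟨b', hb⟩ := hP.quotFunctor_map_surjective (b ≫ L.quotFunctor.map j)
  rw [← cancel_mono (L.quotFunctor.map j), ← ha, ← hb]
  congr 1
  refine Pi.hom_ext _ _ fun i => (hx i).quotFunctor_map_injective ?_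
  rw [Functor.map_comp, Functor.map_comp, ha, hb, Category.assoc, Category.assoc,
    ← Functor.map_comp]
  exact h _ (hx i) _

/-! ### Elements of the center -/

section Center

variable {L : LocalizingSubcategory C} {φ : ∀ x : InjectiveSpectrum C, x.rep ⟶ x.rep}

/-- A morphism out of an infinite product is not determined by its restrictions to the factors, so
commutation with `φ` is first tested along morphisms from finite sums. For a single `E_t`, both `e`
(coordinatewise) and `e ≫ f` commute with `φ`. -/
lemma IsFiniteSum.comp_piMap_comp
    (hφ : ∀ x ∈ torsionFreeLocus L, ∀ y ∈ torsionFreeLocus L, ∀ f : x.rep ⟶ y.rep,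
      φ x ≫ f = f ≫ φ y) {ι : Type v} {x : ι → InjectiveSpectrum C}
    (hx : ∀ i, x i ∈ torsionFreeLocus L) {y : InjectiveSpectrum C} (hy : y ∈ torsionFreeLocus L)
    (f : (∏ᶜ fun i => (x i).rep) ⟶ y.rep) {Q : C} (hQ : IsFiniteSum (torsionFreeReps L) Q)
    (e : Q ⟶ ∏ᶜ fun i => (x i).rep) :
    e ≫ Limits.Pi.map (fun i => φ (x i)) ≫ f = e ≫ f ≫ φ y := by
  induction hQ with
  | of_isZero hX => exact hX.eq_of_src _ _
  | of hX =>
    obtain ⟨t, ht, rfl⟩ := hX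
    have : e ≫ Limits.Pi.map (fun i => φ (x i)) = φ t ≫ e := by
      refine Pi.hom_ext _ _ fun i => ?_
      simp [hφ t ht _ (hx i) (e ≫ Pi.π _ i)]
    rw [reassoc_of% this, hφ t ht y hy (e ≫ f), Category.assoc]
  | biprod _ _ h₁ h₂ =>
    ext
    · simpa using h₁ (biprod.inl ≫ e)
    · simpa using h₂ (biprod.inr ≫ e)

/-- Noetherian objects detect equality, and a morphism from one to a torsion-free injective product
factors through a finite sum of torsion-free `E_x`. -/
lemma piMap_comp_eq (hC : IsLocallyNoetherianCategory C)
    (hφ : ∀ x ∈ torsionFreeLocus L, ∀ y ∈ torsionFreeLocus L, ∀ f : x.rep ⟶ y.rep,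
      φ x ≫ f = f ≫ φ y) {ι : Type v} {x : ι → InjectiveSpectrum C}
    (hx : ∀ i, x i ∈ torsionFreeLocus L) {y : InjectiveSpectrum C} (hy : y ∈ torsionFreeLocus L)
    (f : (∏ᶜ fun i => (x i).rep) ⟶ y.rep) :
    Limits.Pi.map (fun i => φ (x i)) ≫ f = f ≫ φ y := by
  refine hom_ext_of_isNoetherianObject hC fun N _ n => ?_
  obtain ⟨Q, h, hQ, hh⟩ := exists_monoModSerre_isFiniteSum L N N (𝟙 N)
  obtain ⟨e, rfl⟩ := (IsTorsionFree.product (L := L) hx).exists_extension hh n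
  rw [Category.assoc, Category.assoc, hQ.comp_piMap_comp hφ hx hy]

/-- In `C/L` the object `X` becomes a subobject of a product of torsion-free `E_x`, on which `φ`
acts factorwise; the action preserves `X` and is restricted to it. -/
lemma exists_quotFunctor_endomorphism (hC : IsLocallyNoetherianCategory C)
    (hφ : ∀ x ∈ torsionFreeLocus L, ∀ y ∈ torsionFreeLocus L, ∀ f : x.rep ⟶ y.rep,
      φ x ≫ f = f ≫ φ y) (X : C) :
    ∃ z : L.quotFunctor.obj X ⟶ L.quotFunctor.obj X, ∀ x ∈ torsionFreeLocus L,
      ∀ f : X ⟶ x.rep, z ≫ L.quotFunctor.map f = L.quotFunctor.map (f ≫ φ x) := by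
  obtain ⟨ι, x, hx, j, hj⟩ := exists_monoModSerre_product hC L X
  have : IsIso (L.quotFunctor.map (Abelian.factorThruImage j)) :=
    Localization.inverts L.quotFunctor L.prop.isoModSerre _ hj.isoModSerre_factorThruImage
  have := preservesKernel L.quotFunctor L.prop (cokernel.π j)
  let hk := KernelFork.isLimitMapConeEquiv _ L.quotFunctor
    (isLimitOfPreserves L.quotFunctor (kernelIsKernel (cokernel.π j)))
  let p := Limits.Pi.map fun i => φ (x i)
  -- The composite to the cokernel of `j` is tested against the torsion-free `E_y`: a morphism from
  -- the product that kills `j` still kills it after `p`, since `p` commutes past it.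
  have hp : L.quotFunctor.map (j ≫ p) ≫ L.quotFunctor.map (cokernel.π j) = 0 := by
    refine quotFunctor_hom_ext hC L fun y hy f => ?_
    rw [zero_comp, ← Functor.map_comp, ← Functor.map_comp, Category.assoc, Category.assoc,
      piMap_comp_eq hC hφ hx hy, Category.assoc, cokernel.condition_assoc, zero_comp,
      Functor.map_zero]
  obtain ⟨l, hl⟩ : ∃ l : L.quotFunctor.obj X ⟶ L.quotFunctor.obj (Abelian.image j),
      l ≫ L.quotFunctor.map (Abelian.image.ι j) = L.quotFunctor.map (j ≫ p) :=
    ⟨(KernelFork.IsLimit.lift' hk _ hp).1, (KernelFork.IsLimit.lift' hk _ hp).2⟩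
  have hz : (l ≫ inv (L.quotFunctor.map (Abelian.factorThruImage j))) ≫ L.quotFunctor.map j =
      L.quotFunctor.map (j ≫ p) := by
    have : L.quotFunctor.map j = L.quotFunctor.map (Abelian.factorThruImage j) ≫
        L.quotFunctor.map (Abelian.image.ι j) := by
      rw [← Functor.map_comp, Abelian.image.fac]
    rw [this, Category.assoc, IsIso.inv_hom_id_assoc, hl]
  refine ⟨l ≫ inv (L.quotFunctor.map (Abelian.factorThruImage j)), fun y hy f => ?_⟩
  obtain ⟨f, rfl⟩ := IsTorsionFree.exists_extension hy hj f
  rw [Functor.map_comp, ← Category.assoc, hz, ← Functor.map_comp, Category.assoc, Category.assoc,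
    piMap_comp_eq hC hφ hx hy]

/-- A compatible family of endomorphisms of the torsion-free indecomposable injectives comes from
the center of the quotient category. -/
theorem exists_center_of_endomorphisms (hC : IsLocallyNoetherianCategory C)
    (hφ : ∀ x ∈ torsionFreeLocus L, ∀ y ∈ torsionFreeLocus L, ∀ f : x.rep ⟶ y.rep,
      φ x ≫ f = f ≫ φ y) :
    ∃ z : CatCenter L.QuotientCategory, ∀ x ∈ torsionFreeLocus L,
      z.app (L.quotFunctor.obj x.rep) = L.quotFunctor.map (φ x) := by
  choose t ht using exists_quotFunctor_endomorphism (L := L) hC hφ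
  let τ : L.quotFunctor ⟶ L.quotFunctor :=
    { app := t
      naturality X Y g := by
        refine quotFunctor_hom_ext hC L fun x hx f => ?_
        rw [Category.assoc, Category.assoc, ht _ x hx, ← Functor.map_comp, ← Functor.map_comp,
          ht _ x hx, Category.assoc] }
  refine ⟨Localization.liftNatTrans L.quotFunctor L.prop.isoModSerre L.quotFunctor L.quotFunctor
    (𝟭 _) (𝟭 _) τ, fun x hx => ?_⟩
  have h₁ : CatCenter.app (Localization.liftNatTrans L.quotFunctor L.prop.isoModSerre
      L.quotFunctor L.quotFunctor (𝟭 _) (𝟭 _) τ) (L.quotFunctor.obj x.rep) = t x.rep := by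
    simp [τ]
  rw [h₁]
  simpa using ht x.rep x hx (𝟙 _)

/-- The torsion-free `E_x` cogenerate `C/L`, so naturality along morphisms to them determines a
central element. -/
lemma center_ext (hC : IsLocallyNoetherianCategory C) {z z' : CatCenter L.QuotientCategory}
    (h : ∀ x ∈ torsionFreeLocus L,
      z.app (L.quotFunctor.obj x.rep) = z'.app (L.quotFunctor.obj x.rep)) : z = z' := by
  refine CatCenter.ext_of_localization L.quotFunctor L.prop.isoModSerre _ _ fun X => ?_
  refine quotFunctor_hom_ext hC L fun x hx f => ?_
  rw [← CatCenter.naturality, ← CatCenter.naturality, h x hx]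

end Center

/-! ### Restriction and gluing of central elements. -/

lemma centerMap_app_eq {L L' : LocalizingSubcategory C} (h : L ≤ L')
    {z : CatCenter L.QuotientCategory} {X : C} {φ : X ⟶ X}
    (hφ : z.app (L.quotFunctor.obj X) = L.quotFunctor.map φ) :
    CatCenter.app ((centerMap h).hom z : CatCenter L'.QuotientCategory) (L'.quotFunctor.obj X) =
      L'.quotFunctor.map φ := by
  rw [centerMap_app, hφ]
  exact eq_of_heq (congr_arg_heq (fun F : C ⥤ L'.QuotientCategory => F.map φ)
    (quotFunctor_comp_quotMap h))

/-- Gluing of central elements along a covering by stable localizing subcategories. -/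
theorem existsUnique_center (hC : IsLocallyNoetherianCategory C) {ι : Type w}
    {M : LocalizingSubcategory C} {L : ι → LocalizingSubcategory C} (hM : ∀ i, M ≤ L i)
    (hL : ∀ i, (L i).IsStable) (hcover : torsionFreeLocus M ⊆ ⋃ i, torsionFreeLocus (L i))
    {L' : ι → ι → LocalizingSubcategory C} (h₁ : ∀ i j, L i ≤ L' i j) (h₂ : ∀ i j, L j ≤ L' i j)
    (hL' : ∀ i j, torsionFreeLocus (L i) ∩ torsionFreeLocus (L j) ⊆ torsionFreeLocus (L' i j))
    (z : ∀ i, (L i).center)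
    (hz : ∀ i j, centerMap (h₁ i j) (z i) = centerMap (h₂ i j) (z j)) :
    ∃! s : M.center, ∀ i, centerMap (hM i) s = z i := by
  -- Each `z i` is lifted to an endomorphism of `E_x` in `C`; the value `0` off the locus of `L i`
  -- is a dummy.
  have hact (i : ι) (x : InjectiveSpectrum C) : ∃ φ : x.rep ⟶ x.rep,
      x ∈ torsionFreeLocus (L i) → CatCenter.app (z i : CatCenter (L i).QuotientCategory)
        ((L i).quotFunctor.obj x.rep) = (L i).quotFunctor.map φ := by
    by_cases hx : x ∈ torsionFreeLocus (L i)
    · obtain ⟨φ, hφ⟩ := IsTorsionFree.quotFunctor_map_surjective hx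
        (CatCenter.app (z i : CatCenter (L i).QuotientCategory) ((L i).quotFunctor.obj x.rep))
      exact ⟨φ, fun _ => hφ.symm⟩
    · exact ⟨0, fun h => (hx h).elim⟩
  choose ψ hψ using hact
  have hψ' {i j : ι} {x : InjectiveSpectrum C} (hi : x ∈ torsionFreeLocus (L i))
      (hj : x ∈ torsionFreeLocus (L j)) : ψ i x = ψ j x := by
    refine IsTorsionFree.quotFunctor_map_injective (hL' i j ⟨hi, hj⟩) ?_
    rw [← centerMap_app_eq (h₁ i j) (hψ i x hi), ← centerMap_app_eq (h₂ i j) (hψ j x hj)]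
    exact congrArg (fun t : CatCenter (L' i j).QuotientCategory => CatCenter.app t _) (hz i j)
  have hex (x : InjectiveSpectrum C) : ∃ φ : x.rep ⟶ x.rep,
      ∀ i, x ∈ torsionFreeLocus (L i) → φ = ψ i x := by
    by_cases hx : ∃ i, x ∈ torsionFreeLocus (L i)
    · obtain ⟨i, hi⟩ := hx
      exact ⟨ψ i x, fun j hj => hψ' hi hj⟩
    · exact ⟨0, fun i hi => (hx ⟨i, hi⟩).elim⟩
  choose φ hφ using hex
  obtain ⟨s, hs⟩ := exists_center_of_endomorphisms (L := M) (φ := φ) hC (by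
    -- Stability is essential here: no single `L i` need have both `x` and `y` in its locus, but
    -- then `f` vanishes.
    intro x hx y hy f
    obtain ⟨i, hi⟩ := Set.mem_iUnion.1 (hcover hx)
    obtain ⟨j, hj⟩ := Set.mem_iUnion.1 (hcover hy)
    rcases prop_or_isTorsionFree_rep (hL j) x with hx' | hx'
    · rw [hj.eq_zero hx' f, zero_comp, comp_zero]
    · rw [hφ x j hx', hφ y j hj]
      refine IsTorsionFree.quotFunctor_map_injective hj ?_
      rw [Functor.map_comp, Functor.map_comp, ← hψ j x hx', ← hψ j y hj]
      exact (CatCenter.naturality (z j : CatCenter (L j).QuotientCategory) _).symm)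
  refine ⟨s, fun i => ?_, fun s' hs' => ?_⟩
  · refine center_ext (z := ((centerMap (hM i)).hom s : CatCenter _)) (z' := z i) hC fun x hx => ?_
    rw [centerMap_app_eq (hM i) (hs x (torsionFreeLocus_antitone (hM i) hx)), hψ i x hx,
      hφ x i hx]
  · refine center_ext (z := s') (z' := s) hC fun x hx => ?_
    obtain ⟨i, hi⟩ := Set.mem_iUnion.1 (hcover hx)
    -- Uniqueness is checked in `C`: the lift `χ` of `s'` equals `φ x` because their images in `C/L
    -- i` agree and `E_x` is `L i`-torsion-free.
    obtain ⟨χ, hχ⟩ := IsTorsionFree.quotFunctor_map_surjective hx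
      (CatCenter.app (s' : CatCenter M.QuotientCategory) (M.quotFunctor.obj x.rep))
    rw [hs x hx, ← hχ]
    congr 1
    refine IsTorsionFree.quotFunctor_map_injective hi ?_
    rw [← centerMap_app_eq (hM i) hχ.symm, hφ x i hi, ← hψ i x hi]
    exact congrArg (fun t : CatCenter (L i).QuotientCategory => CatCenter.app t _) (hs' i)

theorem centralPresheaf_isSheaf (hC : IsLocallyNoetherianCategory C) :
    (centralPresheaf C).IsSheaf := by
  rw [TopCat.Presheaf.isSheaf_iff_isSheafUniqueGluing]
  intro ι U z hz
  -- Every open set is the locus of its stable subcategory, so the covering and overlap conditions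
  -- reduce to identities between open sets.
  have hU (V : Opens (TopCat.of (InjectiveSpectrum C))) :
      (localizingOf (V : Set (InjectiveSpectrum C))).IsStable ∧
        torsionFreeLocus (localizingOf (V : Set (InjectiveSpectrum C))) = V :=
    (isStable_and_torsionFreeLocus_eq_iff hC
      ((isOpen_iff_isStableSubset hC _).1 V.isOpen) _).2 rfl
  refine existsUnique_center hC
    (M := localizingOf ((iSup U : Opens (TopCat.of (InjectiveSpectrum C))) : Set _))
    (L := fun i => localizingOf (U i : Set (InjectiveSpectrum C)))
    (L' := fun i j => localizingOf ((U i ⊓ U j : Opens _) : Set (InjectiveSpectrum C)))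
    (fun i => localizingOf_antitone (leOfHom (Opens.leSupr U i)))
    (fun i => (hU _).1) ?_
    (fun i j => localizingOf_antitone (leOfHom (Opens.infLELeft (U i) (U j))))
    (fun i j => localizingOf_antitone (leOfHom (Opens.infLERight (U i) (U j)))) ?_ z hz
  · rw [(hU _).2, Opens.coe_iSup]
    exact Set.iUnion_mono fun i => (hU (U i)).2.ge
  · intro i j
    rw [(hU _).2, (hU _).2, (hU _).2, Opens.coe_inf]

theorem existsUnique_center_iInf (hC : IsLocallyNoetherianCategory C) {ι : Type w}
    {L : ι → LocalizingSubcategory C} (hL : ∀ i, (L i).IsStable) (z : ∀ i, (L i).center)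
    (hz : ∀ i j, centerMap (le_sup_left : L i ≤ L i ⊔ L j) (z i) =
      centerMap (le_sup_right : L j ≤ L i ⊔ L j) (z j)) :
    ∃! s : (⨅ i, L i).center, ∀ i, centerMap (iInf_le L i) s = z i :=
  existsUnique_center hC (iInf_le L) hL (torsionFreeLocus_iInf hL).le (fun _ _ => le_sup_left)
    (fun _ _ => le_sup_right) (fun i j => (torsionFreeLocus_sup (L i) (L j)).ge) z hz

end Grothendieck

end CentralSheaf

end

theorem mainTheorem3 (C : Type u) [Category.{v} C] [Abelian C] [IsGrothendieckAbelian.{v} C]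
    (hC : IsLocallyNoetherianCategory C) :
    -- the open subsets of the stable topology are exactly the stable subsets
    (∀ A : Set (InjectiveSpectrum C), IsOpen A ↔ InjectiveSpectrum.IsStableSubset A) ∧
    -- for `A` stable, `L_A` is the unique stable localizing subcategory `L` with `A(L) = A`
    (∀ A : Set (InjectiveSpectrum C), InjectiveSpectrum.IsStableSubset A →
      ∀ L : LocalizingSubcategory C,
        (L.IsStable ∧ InjectiveSpectrum.torsionFreeLocus L = A) ↔ L = InjectiveSpectrum.localizingOf A) ∧
    -- `A ↦ Z(C/L_A)` is a sheaf on `Sp(C)`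
    (centralPresheaf C).IsSheaf ∧
    -- `L ↦ Z(C/L)` satisfies the sheaf condition for arbitrary coverings `⨅ i, L i`
    (∀ (ι : Type w) (L : ι → LocalizingSubcategory C), (∀ i, (L i).IsStable) →
      ∀ z : ∀ i, (L i).center,
        (∀ i j, LocalizingSubcategory.centerMap (le_sup_left : L i ≤ L i ⊔ L j) (z i) =
          LocalizingSubcategory.centerMap (le_sup_right : L j ≤ L i ⊔ L j) (z j)) →
        ∃! s : (⨅ i, L i).center, ∀ i, LocalizingSubcategory.centerMap (iInf_le L i) s = z i) :=
  ⟨isOpen_iff_isStableSubset hC, fun _ hA L => isStable_and_torsionFreeLocus_eq_iff hC hA L,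
    centralPresheaf_isSheaf hC, fun _ _ hL z hz => existsUnique_center_iInf hC hL z hz⟩
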